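/- Let $d\ge 1$, $\overline{\mathbb R}^n=\mathbb R^n\cup\{\infty\}$, and let $S^d$ be the unit sphere of $\mathbb R^{d+1}$. Write $\theta=\mu+i\sigma$ with $\mu\in\mathbb R^d$, $\sigma\in\mathbb R$ for the elements of $\mathbb R^d+i\mathbb R$, with $\|\theta\|=(\|\mu\|^2+\sigma^2)^{1/2}$, and identify $x\in\mathbb R^d$ with $x+i0$, so that $\overline{\mathbb R}^d\subset(\mathbb R^d+i\mathbb R)\cup\{\infty\}$. For $\theta=\mu+i\sigma$ with $\sigma\ne0$, let $C_d(\theta)$ be the distribution on $\overline{\mathbb R}^d$ with density $$\frac{2^{d-1}\Gamma\{(d+1)/2\}}{\pi^{(d+1)/2}}\left(\frac{|\sigma|}{\|x-\theta\|^2}\right)^d,\qquad x\in\mathbb R^d,$$ with respect to Lebesgue measure (and no mass at $\infty$); for $\sigma=0$ let $C_d(\theta)$ be the point mass at $\mu$, and let $C_d(\infty)$ be the point mass at $\infty$. For $\phi\in\mathbb R^{d+1}\setminus S^d$, let $C^*_d(\phi)$ be the distribution on $S^d$ with density $$\frac{\Gamma\{(d+1)/2\}}{2\pi^{(d+1)/2}}\left(\frac{|1-\|\phi\|^2|}{\|y-\phi\|^2}\right)^d,\qquad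 y\in S^d,$$ with respect to surface area; for $\phi\in S^d$ let $C^*_d(\phi)$ be the point mass at $\phi$, and let $C^*_d(\infty)$ be the uniform distribution on $S^d$. Let $g:(\mathbb R^d+i\mathbb R)\cup\{\infty\}\to\overline{\mathbb R}^{d+1}$ be the extended inverse stereographic projection, that is, the bijection $$g(\theta)=\frac{2}{\|\theta+i\|^2}\left(\mu_1,\ldots,\mu_d,\frac{\|\theta\|^2-1}{2}\right)'\quad(\theta\ne -i,\infty),\qquad g(-i)=\infty,\qquad g(\infty)=e_{d+1},$$ which maps $\overline{\mathbb R}^d$ onto $S^d$. Then, for every $\theta\in(\mathbb R^d+i\mathbb R)\cup\{\infty\}$ and every $\overline{\mathbb R}^d$-valued random vector $X$, $$X\sim C_d(\theta)\ \Longrightarrow\ g(X)\sim C^*_d\{g(\theta)\}.$$ Equivalently, for every $\phi\in\overline{\mathbb R}^{d+1}$ and every $S^d$-valued random vector $Y$, $$Y\sim C^*_d(\phi)\ \Longrightarrow\ g^{-1}(Y)\sim C_d\{g^{-1}(\phi)\}.$$ -/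

import Mathlib

open MeasureTheory ProbabilityTheory
open scoped OnePoint

namespace CauchyStereo

/-- The Euclidean space `ℝ^n`. -/
abbrev E (n : ℕ) : Type := EuclideanSpace ℝ (Fin n)

/-- The extended Euclidean space `ℝ^n ∪ {∞}` (one-point compactification). -/
abbrev ExtE (n : ℕ) : Type := OnePoint (E n)

/-- The unit sphere `S^d` in `ℝ^(d+1)`. -/
abbrev Sph (d : ℕ) : Type := Metric.sphere (0 : E (d + 1)) 1

/-- Extended complex numbers `θ = μ + i σ` with `μ ∈ ℝ^d` and `σ ∈ ℝ`,
with `‖θ‖ = (‖μ‖² + σ²)^(1/2)`. -/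
abbrev Cplx (d : ℕ) : Type := WithLp 2 (E d × ℝ)

/-- The Borel σ-algebra on `ℝ^n ∪ {∞}`. -/
instance instMeasurableSpaceExtE (n : ℕ) : MeasurableSpace (ExtE n) := borel _

instance instBorelSpaceExtE (n : ℕ) : BorelSpace (ExtE n) := ⟨rfl⟩

/-- `μ + i σ`. -/
def mkC {d : ℕ} (μ : E d) (σ : ℝ) : Cplx d := WithLp.toLp 2 (μ, σ)

/-- The imaginary unit `i`. -/
def imI (d : ℕ) : Cplx d := mkC 0 1

/-- The inclusion of `ℝ^d ∪ {∞}` into `(ℝ^d + i ℝ) ∪ {∞}`: `x ↦ x + 0 i`, `∞ ↦ ∞`. -/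
def incl {d : ℕ} : ExtE d → OnePoint (Cplx d) := OnePoint.map (fun x => mkC x 0)

/-- The vector `(x_1, …, x_d, t)` of `ℝ^(d+1)`. -/
def append {d : ℕ} (x : E d) (t : ℝ) : E (d + 1) :=
  WithLp.toLp 2 (Fin.snoc (α := fun _ => ℝ) (fun j => x j) t)

/-- The vector `(y_1, …, y_d)` of the first `d` coordinates of `y ∈ ℝ^(d+1)`. -/
def firstCoords {d : ℕ} (y : E (d + 1)) : E d := WithLp.toLp 2 (fun j => y j.castSucc)

/-- The north pole `e_{d+1}`. -/
def north (d : ℕ) : E (d + 1) := append 0 1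

theorem norm_sq_append {d : ℕ} (x : E d) (t : ℝ) : ‖append x t‖ ^ 2 = ‖x‖ ^ 2 + t ^ 2 := by
  simp [append, EuclideanSpace.real_norm_sq_eq, Fin.sum_univ_castSucc]

theorem norm_sq_mkC {d : ℕ} (μ : E d) (σ : ℝ) : ‖mkC μ σ‖ ^ 2 = ‖μ‖ ^ 2 + σ ^ 2 := by
  simp [mkC, WithLp.prod_norm_sq_eq_of_L2]

theorem smul_append {d : ℕ} (c : ℝ) (x : E d) (t : ℝ) :
    c • append x t = append (c • x) (c * t) := by
  ext j
  refine Fin.lastCases ?_ (fun j => ?_) j <;> simp [append]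

theorem append_sub {d : ℕ} (x y : E d) (s t : ℝ) :
    append x s - append y t = append (x - y) (s - t) := by
  ext j
  refine Fin.lastCases ?_ (fun j => ?_) j <;> simp [append]

theorem append_surj {d : ℕ} (y : E (d + 1)) : ∃ x t, y = append (d := d) x t := by
  refine ⟨firstCoords y, y (Fin.last d), ?_⟩
  ext j
  refine Fin.lastCases ?_ (fun j => ?_) j <;> simp [append, firstCoords]

theorem append_inj {d : ℕ} {x y : E d} {s t : ℝ} (h : append x s = append y t) :
    x = y ∧ s = t := by
  constructor
  · ext j
    simpa [append] using congrArg (fun v : E (d + 1) => v j.castSucc) h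
  · simpa [append] using congrArg (fun v : E (d + 1) => v (Fin.last d)) h

@[simp] theorem firstCoords_append {d : ℕ} (x : E d) (t : ℝ) : firstCoords (append x t) = x := by
  ext j
  simp [append, firstCoords]

open Classical in
/-- The extended inverse stereographic projection
`g(θ) = 2 / ‖θ + i‖² · (μ_1, …, μ_d, (‖θ‖² - 1) / 2)`, `g(-i) = ∞`, `g(∞) = e_{d+1}`. -/
noncomputable def gFun {d : ℕ} : OnePoint (Cplx d) → ExtE (d + 1) := fun θ =>
  θ.elim (north d : ExtE (d + 1)) fun θ =>
    if θ = -imI d then ∞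
    else (((2 / ‖θ + imI d‖ ^ 2) • append θ.fst ((‖θ‖ ^ 2 - 1) / 2) : E (d + 1)) : ExtE (d + 1))

open Classical in
/-- The inverse of `gFun`:
`φ ↦ 2 / ‖φ - e_{d+1}‖² · ((φ_1, …, φ_d) + i (1 - ‖φ‖²) / 2)`, `e_{d+1} ↦ ∞`, `∞ ↦ -i`. -/
noncomputable def gInv {d : ℕ} : ExtE (d + 1) → OnePoint (Cplx d) := fun φ =>
  φ.elim (((-imI d : Cplx d)) : OnePoint (Cplx d)) fun φ =>
    if φ = north d then ∞
    else (((2 / ‖φ - north d‖ ^ 2) • mkC (firstCoords φ) ((1 - ‖φ‖ ^ 2) / 2) : Cplx d) :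
      OnePoint (Cplx d))

theorem mkC_add {d : ℕ} (x y : E d) (s t : ℝ) : mkC x s + mkC y t = mkC (x + y) (s + t) := rfl
theorem neg_mkC {d : ℕ} (x : E d) (s : ℝ) : -mkC x s = mkC (-x) (-s) := rfl
theorem smul_mkC {d : ℕ} (c : ℝ) (x : E d) (s : ℝ) : c • mkC x s = mkC (c • x) (c * s) := rfl
@[simp] theorem mkC_fst {d : ℕ} (x : E d) (s : ℝ) : (mkC x s).fst = x := rfl

theorem mkC_inj {d : ℕ} {x y : E d} {s t : ℝ} (h : mkC x s = mkC y t) : x = y ∧ s = t :=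
  ⟨congrArg WithLp.fst h, congrArg WithLp.snd h⟩

theorem norm_sq_mkC_add {d : ℕ} (μ : E d) (σ : ℝ) :
    ‖mkC μ σ + imI d‖ ^ 2 = ‖μ‖ ^ 2 + (σ + 1) ^ 2 := by
  rw [imI, mkC_add, norm_sq_mkC, add_zero]

theorem norm_sq_append_sub {d : ℕ} (x : E d) (t : ℝ) :
    ‖append x t - north d‖ ^ 2 = ‖x‖ ^ 2 + (t - 1) ^ 2 := by
  rw [north, append_sub, norm_sq_append, sub_zero]

theorem pos_of_ne_neg_imI {d : ℕ} {μ : E d} {σ : ℝ} (h : mkC μ σ ≠ -imI d) :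
    0 < ‖μ‖ ^ 2 + (σ + 1) ^ 2 := by
  rw [← norm_sq_mkC_add]
  have : mkC μ σ + imI d ≠ 0 := fun h' => h (eq_neg_of_add_eq_zero_left h')
  positivity

theorem pos_of_ne_north {d : ℕ} {x : E d} {t : ℝ} (h : append x t ≠ north d) :
    0 < ‖x‖ ^ 2 + (t - 1) ^ 2 := by
  rw [← norm_sq_append_sub]
  have : append x t - north d ≠ 0 := sub_ne_zero.2 h
  positivity

theorem gFun_infty {d : ℕ} : gFun (∞ : OnePoint (Cplx d)) = (north d : ExtE (d + 1)) := rfl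

theorem gInv_infty {d : ℕ} : gInv (∞ : ExtE (d + 1)) = ((-imI d : Cplx d) : OnePoint (Cplx d)) :=
  rfl

theorem gFun_neg_imI {d : ℕ} : gFun ((-imI d : Cplx d) : OnePoint (Cplx d)) = ∞ := by
  simp [gFun]

theorem gInv_north {d : ℕ} : gInv (north d : ExtE (d + 1)) = ∞ := by
  simp [gInv]

theorem gFun_mkC {d : ℕ} {μ : E d} {σ : ℝ} (h : mkC μ σ ≠ -imI d) :
    gFun (mkC μ σ : OnePoint (Cplx d)) =
      ((append ((2 / (‖μ‖ ^ 2 + (σ + 1) ^ 2)) • μ)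
        ((‖μ‖ ^ 2 + σ ^ 2 - 1) / (‖μ‖ ^ 2 + (σ + 1) ^ 2)) : E (d + 1)) : ExtE (d + 1)) := by
  have hN := pos_of_ne_neg_imI h
  simp only [gFun, OnePoint.elim_some, if_neg h, smul_append, mkC_fst, norm_sq_mkC_add,
    norm_sq_mkC]
  congr 2
  field_simp

theorem gInv_append {d : ℕ} {x : E d} {t : ℝ} (h : append x t ≠ north d) :
    gInv (append x t : ExtE (d + 1)) =
      ((mkC ((2 / (‖x‖ ^ 2 + (t - 1) ^ 2)) • x)
        ((1 - ‖x‖ ^ 2 - t ^ 2) / (‖x‖ ^ 2 + (t - 1) ^ 2)) : Cplx d) : OnePoint (Cplx d)) := by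
  have hN := pos_of_ne_north h
  simp only [gInv, OnePoint.elim_some, if_neg h, smul_mkC, firstCoords_append,
    norm_sq_append_sub, norm_sq_append]
  congr 2
  field_simp
  ring

theorem gInv_gFun {d : ℕ} (θ : OnePoint (Cplx d)) : gInv (gFun θ) = θ := by
  induction θ using OnePoint.rec with
  | infty => rw [gFun_infty, gInv_north]
  | coe θ =>
    obtain ⟨μ, σ, rfl⟩ : ∃ μ σ, θ = mkC μ σ := ⟨θ.fst, θ.snd, rfl⟩
    by_cases h : mkC μ σ = -imI d
    · rw [h, gFun_neg_imI, gInv_infty]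
    have hN := pos_of_ne_neg_imI h
    set N := ‖μ‖ ^ 2 + (σ + 1) ^ 2 with hNdef
    have hM : ‖(2 / N) • μ‖ ^ 2 + ((‖μ‖ ^ 2 + σ ^ 2 - 1) / N - 1) ^ 2 = 4 / N := by
      rw [norm_smul, mul_pow, Real.norm_eq_abs, sq_abs]
      have : ‖μ‖ ^ 2 = N - (σ + 1) ^ 2 := by rw [hNdef]; ring
      rw [this]
      field_simp
      ring
    have h' : append ((2 / N) • μ) ((‖μ‖ ^ 2 + σ ^ 2 - 1) / N) ≠ north d := by
      intro e
      have := norm_sq_append_sub ((2 / N) • μ) ((‖μ‖ ^ 2 + σ ^ 2 - 1) / N)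
      rw [hM, e, sub_self, norm_zero] at this
      have : 0 < 4 / N := by positivity
      simp_all
    rw [gFun_mkC h, gInv_append h', hM]
    congr 2
    · rw [smul_smul]
      have : 2 / (4 / N) * (2 / N) = 1 := by field_simp; norm_num
      rw [this, one_smul]
    · rw [norm_smul, mul_pow, Real.norm_eq_abs, sq_abs]
      have : ‖μ‖ ^ 2 = N - (σ + 1) ^ 2 := by rw [hNdef]; ring
      rw [this]
      field_simp
      ring

theorem gFun_gInv {d : ℕ} (φ : ExtE (d + 1)) : gFun (gInv φ) = φ := by
  induction φ using OnePoint.rec with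
  | infty => rw [gInv_infty, gFun_neg_imI]
  | coe φ =>
    obtain ⟨x, t, rfl⟩ := append_surj φ
    by_cases h : append x t = north d
    · rw [h, gInv_north, gFun_infty]
    have hN := pos_of_ne_north h
    set N := ‖x‖ ^ 2 + (t - 1) ^ 2 with hNdef
    have hM : ‖(2 / N) • x‖ ^ 2 + ((1 - ‖x‖ ^ 2 - t ^ 2) / N + 1) ^ 2 = 4 / N := by
      rw [norm_smul, mul_pow, Real.norm_eq_abs, sq_abs]
      have : ‖x‖ ^ 2 = N - (t - 1) ^ 2 := by rw [hNdef]; ring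
      rw [this]
      field_simp
      ring
    have h' : mkC ((2 / N) • x) ((1 - ‖x‖ ^ 2 - t ^ 2) / N) ≠ -imI d := by
      intro e
      have := norm_sq_mkC_add ((2 / N) • x) ((1 - ‖x‖ ^ 2 - t ^ 2) / N)
      rw [hM, e, neg_add_cancel, norm_zero] at this
      have : 0 < 4 / N := by positivity
      simp_all
    rw [gInv_append h, gFun_mkC h', hM]
    congr 2
    · rw [smul_smul]
      have : 2 / (4 / N) * (2 / N) = 1 := by field_simp; norm_num
      rw [this, one_smul]
    · rw [norm_smul, mul_pow, Real.norm_eq_abs, sq_abs]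
      have : ‖x‖ ^ 2 = N - (t - 1) ^ 2 := by rw [hNdef]; ring
      rw [this]
      field_simp
      ring

/-- The extended inverse stereographic projection
`g : (ℝ^d + i ℝ) ∪ {∞} → ℝ^(d+1) ∪ {∞}` as a bijection. -/
noncomputable def g (d : ℕ) : OnePoint (Cplx d) ≃ ExtE (d + 1) where
  toFun := gFun
  invFun := gInv
  left_inv := gInv_gFun
  right_inv := gFun_gInv

/-- The inclusion of `S^d` into `ℝ^(d+1) ∪ {∞}`. -/
def sphIncl {d : ℕ} (y : Sph d) : ExtE (d + 1) := ((y : E (d + 1)) : ExtE (d + 1))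

theorem norm_north (d : ℕ) : ‖north d‖ = 1 := by
  rw [← sq_eq_sq₀ (norm_nonneg _) zero_le_one, north, norm_sq_append]
  simp

/-- `g` maps `ℝ^d ∪ {∞}` into `S^d`. -/
theorem exists_sph {d : ℕ} (x : ExtE d) : ∃ y : Sph d, sphIncl y = g d (incl x) := by
  induction x using OnePoint.rec with
  | infty => exact ⟨⟨north d, by simp [norm_north]⟩, rfl⟩
  | coe x =>
    have h : mkC x 0 ≠ -imI d := by
      intro h
      have := (mkC_inj (h.trans (neg_mkC 0 1))).2
      norm_num at this
    refine ⟨⟨append ((2 / (‖x‖ ^ 2 + (0 + 1) ^ 2)) • x)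
      ((‖x‖ ^ 2 + 0 ^ 2 - 1) / (‖x‖ ^ 2 + (0 + 1) ^ 2)), ?_⟩, (gFun_mkC h).symm⟩
    rw [mem_sphere_zero_iff_norm, ← sq_eq_sq₀ (norm_nonneg _) zero_le_one, norm_sq_append,
      norm_smul, mul_pow, Real.norm_eq_abs, sq_abs]
    have : ‖x‖ ^ 2 + (0 + 1) ^ 2 ≠ 0 := by positivity
    field_simp
    ring

/-- `g⁻¹` maps `S^d` into `ℝ^d ∪ {∞}`. -/
theorem exists_ext {d : ℕ} (y : Sph d) : ∃ x : ExtE d, incl x = (g d).symm (sphIncl y) := by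
  obtain ⟨y, hy⟩ := y
  obtain ⟨x, t, rfl⟩ := append_surj y
  by_cases h : append x t = north d
  · refine ⟨∞, ?_⟩
    simp only [sphIncl, h]
    exact gInv_north.symm
  · rw [mem_sphere_zero_iff_norm, ← sq_eq_sq₀ (norm_nonneg _) zero_le_one, norm_sq_append] at hy
    refine ⟨((2 / (‖x‖ ^ 2 + (t - 1) ^ 2)) • x : E d), ((gInv_append h).trans ?_).symm⟩
    have : 1 - ‖x‖ ^ 2 - t ^ 2 = 0 := by linarith
    rw [this, zero_div]
    rfl

theorem incl_injective (d : ℕ) : Function.Injective (incl (d := d)) :=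
  Option.map_injective fun _ _ h => (mkC_inj h).1

theorem sphIncl_injective (d : ℕ) : Function.Injective (sphIncl (d := d)) :=
  fun _ _ h => Subtype.ext (OnePoint.coe_injective h)

/-- The restriction of `g` to a bijection `ℝ^d ∪ {∞} → S^d`, the inverse stereographic projection:
the value at `x` is the point `y` of `S^d` with `y = g(x)`, and the value of the inverse at `y` is
the point `x` of `ℝ^d ∪ {∞}` with `x = g⁻¹(y)`. -/
noncomputable def gReal (d : ℕ) : ExtE d ≃ Sph d where
  toFun x := (exists_sph x).choose
  invFun y := (exists_ext y).choose
  left_inv x := incl_injective d <| by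
    rw [(exists_ext _).choose_spec, (exists_sph x).choose_spec, Equiv.symm_apply_apply]
  right_inv y := sphIncl_injective d <| by
    rw [(exists_sph _).choose_spec, (exists_ext y).choose_spec, Equiv.apply_symm_apply]

theorem sphIncl_gReal {d : ℕ} (x : ExtE d) : sphIncl (gReal d x) = g d (incl x) :=
  (exists_sph x).choose_spec

theorem incl_gReal_symm {d : ℕ} (y : Sph d) : incl ((gReal d).symm y) = (g d).symm (sphIncl y) :=
  (exists_ext y).choose_spec

/-- The density of the Cauchy family on `ℝ^d ∪ {∞}` at `x ∈ ℝ^d`, for `θ = μ + i σ`, `σ ≠ 0`. -/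
noncomputable def cauchyDensity (d : ℕ) (θ : Cplx d) (x : E d) : ℝ :=
  (2 : ℝ) ^ ((d : ℝ) - 1) * Real.Gamma (((d : ℝ) + 1) / 2) / Real.pi ^ (((d : ℝ) + 1) / 2) *
    (|θ.snd| / ‖mkC x 0 - θ‖ ^ 2) ^ d

open Classical in
/-- The Cauchy distribution `C_d(θ)` on `ℝ^d ∪ {∞}`: for `θ = μ + i σ` with `σ ≠ 0` it has the
density `cauchyDensity d θ` with respect to Lebesgue measure on `ℝ^d` (and no mass at `∞`),
for `σ = 0` it is the point mass at `μ`, and for `θ = ∞` the point mass at `∞`. -/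
noncomputable def cauchyLaw (d : ℕ) (θ : OnePoint (Cplx d)) : Measure (ExtE d) :=
  θ.elim (Measure.dirac ∞) fun θ =>
    if θ.snd = 0 then Measure.dirac (θ.fst : ExtE d)
    else ((volume : Measure (E d)).withDensity
      fun x => ENNReal.ofReal (cauchyDensity d θ x)).map (fun x : E d => (x : ExtE d))

/-- The surface area measure of `S^d`. -/
noncomputable def area (d : ℕ) : Measure (Sph d) := (volume : Measure (E (d + 1))).toSphere

/-- The density of the Cauchy family on `S^d` at `y`, for `φ ∈ ℝ^(d+1) \ S^d`. -/
noncomputable def sphCauchyDensity (d : ℕ) (φ : E (d + 1)) (y : Sph d) : ℝ :=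
  Real.Gamma (((d : ℝ) + 1) / 2) / (2 * Real.pi ^ (((d : ℝ) + 1) / 2)) *
    (|1 - ‖φ‖ ^ 2| / ‖(y : E (d + 1)) - φ‖ ^ 2) ^ d

open Classical in
/-- The Cauchy distribution `C*_d(φ)` on `S^d`: for `φ ∈ ℝ^(d+1) \ S^d` it has the density
`sphCauchyDensity d φ` with respect to surface area, for `φ ∈ S^d` it is the point mass at `φ`,
and for `φ = ∞` it is the uniform distribution. -/
noncomputable def sphCauchyLaw (d : ℕ) (φ : ExtE (d + 1)) : Measure (Sph d) :=
  φ.elim ((area d Set.univ)⁻¹ • area d) fun φ =>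
    if h : φ ∈ Metric.sphere (0 : E (d + 1)) 1 then Measure.dirac (⟨φ, h⟩ : Sph d)
    else (area d).withDensity fun y => ENNReal.ofReal (sphCauchyDensity d φ y)

end CauchyStereo

namespace CauchyStereo

open EuclideanGeometry Set
open scoped Pointwise

/-! Two facts carry the result. Stereographic coordinates turn surface area into `(2 / (‖x‖² + 1))^d
dx` (`area_image`, `map_withDensity_eq_area`), and the kernels match up to that same conformal
factor (`kernel_gReal`), because `1 - ‖g θ‖² = 4σ / ‖θ + i‖²` and `‖g x - g θ‖² = 4‖x - θ‖² / (‖x +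
i‖² ‖θ + i‖²)`.

For the area, surface measure is read off from the volume of cones. On the equatorial hyperplane `g`
is an inversion centred at the north pole, so the cone map `(x, t) ↦ t • g x` has as derivative a
reflection composed with a map scaling `d` directions by `2t / (‖x‖² + 1)`. Its Jacobian is the
`d`-th power of this scale, and integrating `t^d` over `(0, 1)` cancels the dimension factor.

The case `θ = -i` gives the uniform law, and real or infinite `θ` give point masses. The converse
follows since `g` is a bijection. -/

/-- The isometry between `ℝ^d + i ℝ` and `ℝ^(d+1)`. -/
noncomputable def cplxEquiv (d : ℕ) : Cplx d ≃ₗᵢ[ℝ] E (d + 1) where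
  toFun θ := append θ.fst θ.snd
  invFun z := mkC (firstCoords z) (z (Fin.last d))
  left_inv θ := by
    obtain ⟨μ, σ, rfl⟩ : ∃ μ σ, θ = mkC μ σ := ⟨θ.fst, θ.snd, rfl⟩
    exact congrArg₂ mkC (firstCoords_append μ σ) (by simp [append, mkC])
  right_inv z := by
    obtain ⟨x, t, rfl⟩ := append_surj z
    exact congrArg₂ append (firstCoords_append x t) (by simp [append, mkC])
  map_add' θ η := by
    ext j
    refine Fin.lastCases ?_ (fun j => ?_) j <;> simp [append]
  map_smul' c θ := by
    simp [smul_append]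
  norm_map' θ := by
    obtain ⟨μ, σ, rfl⟩ : ∃ μ σ, θ = mkC μ σ := ⟨θ.fst, θ.snd, rfl⟩
    rw [← sq_eq_sq₀ (norm_nonneg _) (norm_nonneg _), norm_sq_mkC]
    exact norm_sq_append _ _

theorem measurePreserving_append (d : ℕ) :
    MeasurePreserving (fun p : E d × ℝ => append p.1 p.2) :=
  (cplxEquiv d).measurePreserving.comp (WithLp.volume_preserving_toLp (E d) ℝ)

theorem measurableEmbedding_append (d : ℕ) :
    MeasurableEmbedding (fun p : E d × ℝ => append p.1 p.2) :=
  (cplxEquiv d).toHomeomorph.measurableEmbedding.comp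
    (MeasurableEquiv.toLp 2 (E d × ℝ)).measurableEmbedding

@[simp] theorem append_last {d : ℕ} (x : E d) (t : ℝ) : append x t (Fin.last d) = t := by
  simp [append]

/-- The orthogonal projection of `ℝ^(d+1)` onto the equatorial hyperplane. -/
noncomputable def equator (d : ℕ) : E (d + 1) →L[ℝ] E (d + 1) :=
  ContinuousLinearMap.id ℝ _ -
    (EuclideanSpace.proj (Fin.last d) : E (d + 1) →L[ℝ] ℝ).smulRight (north d)

theorem equator_append {d : ℕ} (x : E d) (t : ℝ) : equator d (append x t) = append x 0 := by
  simp [equator, north, smul_append, append_sub]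

/-- The linear map which scales the equatorial hyperplane by `c` and fixes the north pole. -/
noncomputable def axisScale (d : ℕ) (c : ℝ) : E (d + 1) →L[ℝ] E (d + 1) :=
  c • equator d + (EuclideanSpace.proj (Fin.last d) : E (d + 1) →L[ℝ] ℝ).smulRight (north d)

theorem det_axisScale (d : ℕ) (c : ℝ) : (axisScale d c).det = c ^ d := by
  have h : ((axisScale d c : E (d + 1) →L[ℝ] E (d + 1)) : E (d + 1) →ₗ[ℝ] E (d + 1)) =
      Matrix.toLpLin 2 2 (Matrix.diagonal (Fin.snoc (α := fun _ => ℝ) (fun _ : Fin d => c) 1)) := by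
    refine LinearMap.ext fun z => ?_
    ext j
    refine Fin.lastCases ?_ (fun j => ?_) j <;>
      simp [axisScale, equator, north, append, Matrix.mulVec_diagonal]
  rw [ContinuousLinearMap.det, h, Matrix.toLpLin_eq_toLin, LinearMap.det_toLin]
  simp [Fin.prod_univ_castSucc]

/-! ### The projection as an inversion, and its cone map -/

theorem mkC_ne_neg_imI {d : ℕ} (x : E d) : mkC x 0 ≠ -imI d := by
  intro h
  have := (mkC_inj (h.trans (neg_mkC 0 1))).2
  norm_num at this

theorem coe_gReal_coe_eq_append {d : ℕ} (x : E d) :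
    (gReal d (x : ExtE d) : E (d + 1)) =
      append ((2 / (‖x‖ ^ 2 + 1)) • x) ((‖x‖ ^ 2 - 1) / (‖x‖ ^ 2 + 1)) := by
  simpa using OnePoint.coe_injective
    ((sphIncl_gReal (x : ExtE d)).trans (gFun_mkC (mkC_ne_neg_imI x)))

theorem coe_gReal_coe {d : ℕ} (x : E d) :
    (gReal d (x : ExtE d) : E (d + 1)) = inversion (north d) √2 (append x 0) := by
  have hN : ‖x‖ ^ 2 + 1 ≠ 0 := by positivity
  rw [coe_gReal_coe_eq_append, inversion, dist_eq_norm, div_pow, norm_sq_append_sub,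
    Real.sq_sqrt zero_le_two, vsub_eq_sub, vadd_eq_add, ← sub_eq_iff_eq_add, north, append_sub,
    append_sub, smul_append]
  norm_num
  congr 1
  field_simp
  ring

theorem append_zero_ne_north {d : ℕ} (x : E d) : append x 0 ≠ north d := fun h => by
  simpa using (append_inj h).2

/-- With `v = x - e_{d+1}`, both sides equal `e_{d+1} + (2 / ‖v‖²) v`, since `⟪v, e_{d+1}⟫ = -1`.
Thus the radial column of the cone map's derivative comes from the same reflection as the derivative
of the inversion. -/
theorem reflection_north {d : ℕ} (x : E d) :
    (Submodule.span ℝ {append x 0 - north d})ᗮ.reflection (north d) =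
      inversion (north d) √2 (append x 0) := by
  have hi : inner ℝ (append x 0 - north d) (north d) = (-1 : ℝ) := by
    simp [north, append, PiLp.inner_apply, Fin.sum_univ_castSucc]
  have hN : ‖append x 0 - north d‖ ≠ 0 := norm_ne_zero_iff.2 (sub_ne_zero.2 (append_zero_ne_north x))
  rw [Submodule.reflection_orthogonal_apply, Submodule.reflection_singleton_apply, hi, inversion,
    dist_eq_norm, div_pow, Real.sq_sqrt zero_le_two, vsub_eq_sub, vadd_eq_add]
  simp only [div_eq_mul_inv, neg_mul, one_mul, ← Nat.cast_smul_eq_nsmul ℝ, smul_smul, neg_smul,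
    smul_neg, neg_sub, RCLike.ofReal_real_eq_id, id_eq, Nat.cast_ofNat]
  module

/-- Radial extension of the inverse stereographic projection: the point at height `r` above `x` is
sent to `r` times the image of `x`. -/
noncomputable def coneMap (d : ℕ) (z : E (d + 1)) : E (d + 1) :=
  z (Fin.last d) • inversion (north d) √2 (equator d z)

theorem coneMap_append {d : ℕ} (x : E d) (t : ℝ) :
    coneMap d (append x t) = t • (gReal d (x : ExtE d) : E (d + 1)) := by
  rw [coneMap, append_last, equator_append, coe_gReal_coe]

/-- By the product rule, horizontal directions see `t` times the derivative of the inversion, a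
reflection scaled by `2 / (‖x‖² + 1)`; the vertical direction maps to `g x`, which
`reflection_north` writes as the reflected pole. -/
theorem hasFDerivAt_coneMap {d : ℕ} (x : E d) (t : ℝ) :
    HasFDerivAt (coneMap d)
      (((Submodule.span ℝ {append x 0 - north d})ᗮ.reflection : E (d + 1) →L[ℝ] E (d + 1)) ∘L
        axisScale d (t * (2 / (‖x‖ ^ 2 + 1)))) (append x t) := by
  have h0 : equator d (append x t) = append x 0 := equator_append x t
  have h1 := hasFDerivAt_inversion (R := √2) (append_zero_ne_north x)
  rw [← h0] at h1
  have h2 := h1.comp (append x t) (equator d).hasFDerivAt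
  have h3 := (EuclideanSpace.proj (Fin.last d) : E (d + 1) →L[ℝ] ℝ).hasFDerivAt (x := append x t)
  refine (h3.smul h2).congr_fderiv ?_
  have hN : (√2 / dist (append x 0) (north d)) ^ 2 = 2 / (‖x‖ ^ 2 + 1) := by
    rw [dist_eq_norm, div_pow, norm_sq_append_sub, Real.sq_sqrt zero_le_two]
    norm_num
  ext1 v
  simp [axisScale, h0, hN, reflection_north, smul_smul]

theorem abs_det_reflection_comp_axisScale {d : ℕ} (K : Submodule ℝ (E (d + 1)))
    [K.HasOrthogonalProjection] (c : ℝ) :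
    |((K.reflection : E (d + 1) →L[ℝ] E (d + 1)) ∘L axisScale d c).det| = |c| ^ d := by
  have h : ((K.reflection : E (d + 1) →L[ℝ] E (d + 1)) ∘L axisScale d c).det =
      LinearMap.det K.reflection.toLinearMap * (axisScale d c).det :=
    LinearMap.det_comp _ _
  rw [h, Submodule.det_reflection, det_axisScale, abs_mul, abs_pow, abs_pow]
  simp

theorem gReal_coe_injective (d : ℕ) : Function.Injective fun x : E d => gReal d (x : ExtE d) :=
  (gReal d).injective.comp OnePoint.coe_injective

theorem injOn_coneMap (d : ℕ) : InjOn (coneMap d) {z | 0 < z (Fin.last d)} := by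
  intro z hz w hw h
  obtain ⟨x, t, rfl⟩ := append_surj z
  obtain ⟨y, s, rfl⟩ := append_surj w
  simp only [mem_ofPred_eq, append_last] at hz hw
  rw [coneMap_append, coneMap_append] at h
  -- Points of the sphere have norm 1, so the norm recovers the height.
  have hts : t = s := by
    simpa [norm_smul, abs_of_pos hz, abs_of_pos hw] using congrArg norm h
  subst hts
  rw [gReal_coe_injective d (Subtype.ext (smul_right_injective _ hz.ne' h))]

theorem continuous_gReal_coe (d : ℕ) : Continuous fun x : E d => gReal d (x : ExtE d) := by
  refine Continuous.subtype_mk (f := fun x : E d => (gReal d (x : ExtE d) : E (d + 1))) ?_ _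
  simp_rw [coe_gReal_coe]
  refine Continuous.inversion continuous_const continuous_const ?_ append_zero_ne_north
  exact (cplxEquiv d).continuous.comp
    ((WithLp.prod_continuous_toLp 2 (E d) ℝ).comp (Continuous.prodMk_left 0))

theorem measurableEmbedding_gReal_coe (d : ℕ) :
    MeasurableEmbedding fun x : E d => gReal d (x : ExtE d) :=
  (continuous_gReal_coe d).measurableEmbedding (gReal_coe_injective d)

/-! ### Surface area in stereographic coordinates -/

theorem coneMap_image {d : ℕ} (A : Set (E d)) :
    coneMap d '' ((fun p : E d × ℝ => append p.1 p.2) '' A ×ˢ Ioo 0 1) =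
      Ioo (0 : ℝ) 1 • ((↑) '' ((fun x : E d => gReal d (x : ExtE d)) '' A) : Set (E (d + 1))) := by
  ext w
  simp only [image_image, coneMap_append, mem_image, mem_prod, Prod.exists, mem_smul]
  constructor
  · rintro ⟨x, t, ⟨hx, ht⟩, rfl⟩
    exact ⟨t, ht, _, ⟨x, hx, rfl⟩, rfl⟩
  · rintro ⟨t, ht, _, ⟨x, hx, rfl⟩, rfl⟩
    exact ⟨x, t, ⟨hx, ht⟩, rfl⟩

theorem lintegral_Ioo_pow (d : ℕ) :
    ∫⁻ t in Ioo (0 : ℝ) 1, ENNReal.ofReal (t ^ d) = ENNReal.ofReal (1 / (d + 1)) := by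
  rw [← ofReal_integral_eq_lintegral_ofReal, ← integral_Ioc_eq_integral_Ioo,
    ← intervalIntegral.integral_of_le zero_le_one, integral_pow]
  · simp
  · exact ((continuous_pow d).integrableOn_Icc (a := 0) (b := 1)).mono_set Ioo_subset_Icc_self
  · filter_upwards [self_mem_ae_restrict measurableSet_Ioo] with t ht using pow_nonneg ht.1.le d

/-- The surface area of the image of a set under the inverse stereographic projection. -/
theorem area_image {d : ℕ} {A : Set (E d)} (hA : MeasurableSet A) :
    area d ((fun x : E d => gReal d (x : ExtE d)) '' A) =
      ∫⁻ x in A, ENNReal.ofReal ((2 / (‖x‖ ^ 2 + 1)) ^ d) := by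
  have hS : MeasurableSet ((fun p : E d × ℝ => append p.1 p.2) '' A ×ˢ Ioo 0 1) :=
    (measurableEmbedding_append d).measurableSet_image' (hA.prod measurableSet_Ioo)
  -- Surface area is `d + 1` times the volume of the cone over the set.
  rw [area, Measure.toSphere_apply' _ ((measurableEmbedding_gReal_coe d).measurableSet_image' hA),
    ← coneMap_image]
  rw [← lintegral_abs_det_fderiv_eq_addHaar_image volume hS
    (f' := fun z => ((Submodule.span ℝ {append (firstCoords z) 0 - north d})ᗮ.reflection :
      E (d + 1) →L[ℝ] E (d + 1)) ∘L
        axisScale d (z (Fin.last d) * (2 / (‖firstCoords z‖ ^ 2 + 1))))]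
  rotate_left
  · rintro z -
    obtain ⟨x, t, rfl⟩ := append_surj z
    simpa using (hasFDerivAt_coneMap x t).hasFDerivWithinAt
  · refine (injOn_coneMap d).mono ?_
    rintro _ ⟨⟨x, t⟩, ⟨-, ht⟩, rfl⟩
    simpa using ht.1
  simp_rw [abs_det_reflection_comp_axisScale]
  rw [← (measurePreserving_append d).setLIntegral_comp_emb (measurableEmbedding_append d)]
  simp_rw [append_last, firstCoords_append]
  have h1 : ∀ p ∈ A ×ˢ Ioo (0 : ℝ) 1,
      ENNReal.ofReal (|p.2 * (2 / (‖p.1‖ ^ 2 + 1))| ^ d) =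
        ENNReal.ofReal ((2 / (‖p.1‖ ^ 2 + 1)) ^ d) * ENNReal.ofReal (p.2 ^ d) := by
    rintro ⟨x, t⟩ ⟨-, ht⟩
    have ht0 : 0 < t := ht.1
    rw [← ENNReal.ofReal_mul (by positivity), abs_of_pos (by positivity), mul_pow, mul_comm]
  rw [setLIntegral_congr_fun (hA.prod measurableSet_Ioo) h1, Measure.volume_eq_prod,
    ← Measure.prod_restrict,
    lintegral_prod_mul (f := fun x : E d => ENNReal.ofReal ((2 / (‖x‖ ^ 2 + 1)) ^ d))
      (g := fun t : ℝ => ENNReal.ofReal (t ^ d)) (by fun_prop) (by fun_prop), lintegral_Ioo_pow,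
    mul_left_comm]
  -- The integral of `t^d` cancels the factor `d + 1`.
  have h2 : (Module.finrank ℝ (E (d + 1)) : ENNReal) * ENNReal.ofReal (1 / (d + 1)) = 1 := by
    rw [finrank_euclideanSpace_fin, ← ENNReal.ofReal_natCast, ← ENNReal.ofReal_mul (by positivity)]
    push_cast
    rw [mul_one_div_cancel (by positivity), ENNReal.ofReal_one]
  rw [h2, mul_one]

/-- The cone over a point lies in a line, which is null in dimension `d + 1 ≥ 2`. This fails for `d
= 0`. -/
theorem area_singleton {d : ℕ} (hd : 1 ≤ d) (y : Sph d) : area d {y} = 0 := by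
  rw [area, Measure.toSphere_apply' _ (measurableSet_singleton y)]
  refine mul_eq_zero_of_right _ (measure_mono_null (t := (Submodule.span ℝ {(y : E (d + 1))} :
    Set (E (d + 1)))) ?_ (Measure.addHaar_submodule _ _ ?_))
  · rintro _ ⟨t, -, _, ⟨_, rfl, rfl⟩, rfl⟩
    exact Submodule.smul_mem _ _ (Submodule.mem_span_singleton_self _)
  · intro h
    have h1 := finrank_span_le_card (R := ℝ) ({(y : E (d + 1))} : Set (E (d + 1)))
    rw [h, finrank_top, finrank_euclideanSpace_fin] at h1
    simp at h1
    omega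

theorem range_gReal_coe (d : ℕ) :
    range (fun x : E d => gReal d (x : ExtE d)) = {gReal d ∞}ᶜ := by
  rw [show (fun x : E d => gReal d (x : ExtE d)) = gReal d ∘ (↑) from rfl, range_comp,
    ← OnePoint.compl_infty, image_compl_eq (gReal d).bijective, image_singleton]

/-- Surface area is the image of the measure on `ℝ^d` with density `(2 / (1 + ‖x‖²))^d`. -/
theorem map_withDensity_eq_area {d : ℕ} (hd : 1 ≤ d) :
    ((volume : Measure (E d)).withDensity
      fun x => ENNReal.ofReal ((2 / (‖x‖ ^ 2 + 1)) ^ d)).map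
        (fun x : E d => gReal d (x : ExtE d)) = area d := by
  have hm := (measurableEmbedding_gReal_coe d).measurable
  ext B hB
  -- The chart misses only the pole, which is null.
  rw [Measure.map_apply hm hB, withDensity_apply _ (hm hB), ← area_image (hm hB),
    image_preimage_eq_inter_range, range_gReal_coe, ← sdiff_eq,
    measure_sdiff_null (area_singleton hd _)]

theorem withDensity_area {d : ℕ} (hd : 1 ≤ d) {f : Sph d → ENNReal} (hf : Measurable f) :
    (area d).withDensity f = ((volume : Measure (E d)).withDensity
      fun x => ENNReal.ofReal ((2 / (‖x‖ ^ 2 + 1)) ^ d) * f (gReal d (x : ExtE d))).map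
        (fun x : E d => gReal d (x : ExtE d)) := by
  have hm := (measurableEmbedding_gReal_coe d).measurable
  ext B hB
  rw [Measure.map_apply hm hB, withDensity_apply _ (hm hB), withDensity_apply _ hB,
    ← map_withDensity_eq_area hd, setLIntegral_map hB hf hm]
  exact setLIntegral_withDensity_eq_setLIntegral_mul _ (by fun_prop) (hf.comp hm) (hm hB)

/-- Splitting off `∞` avoids any continuity argument there: a subsingleton is measurable. -/
theorem measurable_gReal (d : ℕ) : Measurable (gReal d) := by
  intro B hB
  have h : gReal d ⁻¹' B = (↑) '' ((fun x : E d => gReal d (x : ExtE d)) ⁻¹' B) ∪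
      (gReal d ⁻¹' B ∩ {∞}) := by
    ext x
    induction x using OnePoint.rec <;> simp
  rw [h]
  refine (OnePoint.isOpenEmbedding_coe.measurableEmbedding.measurableSet_image'
    ((measurableEmbedding_gReal_coe d).measurable hB)).union ?_
  exact (Set.subsingleton_singleton.anti inter_subset_right).measurableSet

theorem measurable_gReal_symm (d : ℕ) : Measurable (gReal d).symm := by
  intro A hA
  have h : (gReal d).symm ⁻¹' A = (fun x : E d => gReal d (x : ExtE d)) '' ((↑) ⁻¹' A) ∪
      gReal d '' (A ∩ {∞}) := by
    rw [← (gReal d).image_eq_preimage_symm]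
    ext y
    obtain ⟨x, rfl⟩ := (gReal d).surjective y
    induction x using OnePoint.rec <;> simp
  rw [h]
  refine ((measurableEmbedding_gReal_coe d).measurableSet_image'
    (OnePoint.isOpenEmbedding_coe.measurableEmbedding.measurable hA)).union ?_
  exact ((Set.subsingleton_singleton.anti inter_subset_right).image _).measurableSet


/-! ### Matching kernels and densities -/

theorem norm_sq_mkC_sub {d : ℕ} (x μ : E d) (σ : ℝ) :
    ‖mkC x 0 - mkC μ σ‖ ^ 2 = ‖x - μ‖ ^ 2 + σ ^ 2 := by
  rw [sub_eq_add_neg, neg_mkC, mkC_add, norm_sq_mkC, zero_add, neg_sq, sub_eq_add_neg]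

/-- The Poisson-type kernels of the two families agree up to the conformal factor of the
stereographic projection. -/
theorem kernel_gReal {d : ℕ} {μ : E d} {σ : ℝ} (hσ : σ ≠ 0) (h : mkC μ σ ≠ -imI d)
    {φ : E (d + 1)} (hφ : gFun (mkC μ σ : OnePoint (Cplx d)) = (φ : ExtE (d + 1))) (x : E d) :
    2 / (‖x‖ ^ 2 + 1) * (|1 - ‖φ‖ ^ 2| / ‖(gReal d (x : ExtE d) : E (d + 1)) - φ‖ ^ 2) =
      2 * (|σ| / ‖mkC x 0 - mkC μ σ‖ ^ 2) := by
  have hN := pos_of_ne_neg_imI h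
  rw [gFun_mkC h] at hφ
  rw [← OnePoint.coe_injective hφ, coe_gReal_coe_eq_append, append_sub, norm_sq_append,
    norm_sq_append, norm_sq_mkC_sub]
  have hM : 0 < ‖x‖ ^ 2 + 1 := by positivity
  have hD : 0 < ‖x - μ‖ ^ 2 + σ ^ 2 := by positivity
  -- The factor `‖θ + i‖²` occurs here and in `h2`, and drops out of the quotient.
  have h1 : 1 - (‖(2 / (‖μ‖ ^ 2 + (σ + 1) ^ 2)) • μ‖ ^ 2 +
      ((‖μ‖ ^ 2 + σ ^ 2 - 1) / (‖μ‖ ^ 2 + (σ + 1) ^ 2)) ^ 2) =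
        4 / (‖μ‖ ^ 2 + (σ + 1) ^ 2) * σ := by
    rw [norm_smul, mul_pow, Real.norm_eq_abs, sq_abs]
    field_simp
    ring
  have h2 : ‖(2 / (‖x‖ ^ 2 + 1)) • x - (2 / (‖μ‖ ^ 2 + (σ + 1) ^ 2)) • μ‖ ^ 2 +
      ((‖x‖ ^ 2 - 1) / (‖x‖ ^ 2 + 1) -
        (‖μ‖ ^ 2 + σ ^ 2 - 1) / (‖μ‖ ^ 2 + (σ + 1) ^ 2)) ^ 2 =
        4 * (‖x - μ‖ ^ 2 + σ ^ 2) / ((‖x‖ ^ 2 + 1) * (‖μ‖ ^ 2 + (σ + 1) ^ 2)) := by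
    rw [norm_sub_sq_real, norm_sub_sq_real, norm_smul, norm_smul, mul_pow, mul_pow,
      Real.norm_eq_abs, Real.norm_eq_abs, sq_abs, sq_abs, inner_smul_left, inner_smul_right]
    simp only [conj_trivial]
    field_simp
    ring
  rw [h1, h2, abs_mul, abs_of_pos (div_pos four_pos hN)]
  field_simp

/-- If `‖φ‖ = 1`, the left side of `kernel_gReal` at `x = μ` vanishes, while the right side is `2 /
|σ|`. -/
theorem norm_ne_one_of_gFun {d : ℕ} {μ : E d} {σ : ℝ} (hσ : σ ≠ 0) (h : mkC μ σ ≠ -imI d)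
    {φ : E (d + 1)} (hφ : gFun (mkC μ σ : OnePoint (Cplx d)) = (φ : ExtE (d + 1))) :
    ‖φ‖ ≠ 1 := by
  intro h1
  have := kernel_gReal hσ h hφ μ
  rw [h1, norm_sq_mkC_sub] at this
  simp [hσ] at this

theorem two_rpow_sub_one (d : ℕ) : (2 : ℝ) ^ ((d : ℝ) - 1) = 2 ^ d / 2 := by
  rw [Real.rpow_sub two_pos, Real.rpow_natCast, Real.rpow_one]

theorem sphCauchyDensity_gReal {d : ℕ} {μ : E d} {σ : ℝ} (hσ : σ ≠ 0) (h : mkC μ σ ≠ -imI d)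
    {φ : E (d + 1)} (hφ : gFun (mkC μ σ : OnePoint (Cplx d)) = (φ : ExtE (d + 1))) (x : E d) :
    (2 / (‖x‖ ^ 2 + 1)) ^ d * sphCauchyDensity d φ (gReal d (x : ExtE d)) =
      cauchyDensity d (mkC μ σ) x := by
  rw [sphCauchyDensity, cauchyDensity, mul_left_comm, ← mul_pow, kernel_gReal hσ h hφ,
    two_rpow_sub_one, mul_pow]
  have : 0 < Real.pi ^ (((d : ℝ) + 1) / 2) := by positivity
  change _ * (2 ^ d * (|σ| / _) ^ d) = _ * (|σ| / _) ^ d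
  field_simp

/-- Replaces `kernel_gReal` when `g θ = ∞`: the density is a constant multiple of the conformal
factor. -/
theorem cauchyDensity_neg_imI {d : ℕ} (x : E d) :
    cauchyDensity d (-imI d) x = (2 / (‖x‖ ^ 2 + 1)) ^ d *
      (Real.Gamma (((d : ℝ) + 1) / 2) / (2 * Real.pi ^ (((d : ℝ) + 1) / 2))) := by
  have h : ‖mkC x 0 - -imI d‖ ^ 2 = ‖x‖ ^ 2 + 1 := by
    rw [sub_neg_eq_add, norm_sq_mkC_add]; ring
  have hs : |(-imI d : Cplx d).snd| = 1 := by simp [imI, mkC]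
  have : 0 < Real.pi ^ (((d : ℝ) + 1) / 2) := by positivity
  rw [cauchyDensity, two_rpow_sub_one, h, hs, div_pow, div_pow]
  field_simp
  simp

theorem area_univ (d : ℕ) : area d Set.univ =
    ENNReal.ofReal (2 * Real.pi ^ (((d : ℝ) + 1) / 2) / Real.Gamma (((d : ℝ) + 1) / 2)) := by
  have hG : 0 < Real.Gamma (((d : ℝ) + 1) / 2) := Real.Gamma_pos_of_pos (by positivity)
  rw [area, Measure.toSphere_apply_univ, finrank_euclideanSpace_fin, EuclideanSpace.volume_ball,
    ENNReal.ofReal_one, one_pow, one_mul, ← ENNReal.ofReal_natCast,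
    ← ENNReal.ofReal_mul (by positivity), Fintype.card_fin]
  push_cast
  -- The functional equation of `Γ` absorbs the dimension factor `d + 1`.
  rw [Real.Gamma_add_one (by positivity), Real.sqrt_eq_rpow, ← Real.rpow_natCast,
    ← Real.rpow_mul Real.pi_pos.le]
  push_cast
  rw [show (1 / 2 : ℝ) * (d + 1) = (d + 1) / 2 by ring]
  congr 1
  field_simp

/-! ### Transport of the laws -/

theorem cauchyLaw_mkC {d : ℕ} {μ : E d} {σ : ℝ} (hσ : σ ≠ 0) :
    cauchyLaw d (mkC μ σ : OnePoint (Cplx d)) = ((volume : Measure (E d)).withDensity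
      fun x => ENNReal.ofReal (cauchyDensity d (mkC μ σ) x)).map (fun x : E d => (x : ExtE d)) :=
  if_neg hσ

/-- Reduces equality of laws to a pointwise identity of densities; a constant `f` serves `θ = -i`.
-/
theorem map_gReal_cauchyLaw_of_density {d : ℕ} (hd : 1 ≤ d) {μ : E d} {σ : ℝ} (hσ : σ ≠ 0)
    {f : Sph d → ℝ} (hf : Measurable f)
    (h : ∀ x : E d, (2 / (‖x‖ ^ 2 + 1)) ^ d * f (gReal d (x : ExtE d)) =
      cauchyDensity d (mkC μ σ) x) :
    (cauchyLaw d (mkC μ σ : OnePoint (Cplx d))).map (gReal d) =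
      (area d).withDensity fun y => ENNReal.ofReal (f y) := by
  rw [withDensity_area hd hf.ennreal_ofReal, cauchyLaw_mkC hσ,
    Measure.map_map (measurable_gReal d) OnePoint.isOpenEmbedding_coe.measurableEmbedding.measurable]
  simp_rw [← h, ENNReal.ofReal_mul (pow_nonneg (div_nonneg zero_le_two
    (add_nonneg (sq_nonneg ‖_‖) zero_le_one)) d)]
  rfl

theorem sphCauchyLaw_sphIncl {d : ℕ} (y : Sph d) :
    sphCauchyLaw d (sphIncl y) = Measure.dirac y :=
  dif_pos y.2

theorem map_gReal_dirac {d : ℕ} (x : ExtE d) :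
    (Measure.dirac x).map (gReal d) = sphCauchyLaw d (g d (incl x)) := by
  rw [Measure.map_dirac' (measurable_gReal d), ← sphIncl_gReal, sphCauchyLaw_sphIncl]

/-- The inverse stereographic projection carries `C_d(θ)` to `C*_d(g(θ))`. -/
theorem map_gReal_cauchyLaw {d : ℕ} (hd : 1 ≤ d) (θ : OnePoint (Cplx d)) :
    (cauchyLaw d θ).map (gReal d) = sphCauchyLaw d (g d θ) := by
  induction θ using OnePoint.rec with
  | infty => exact map_gReal_dirac ∞
  | coe θ =>
    obtain ⟨μ, σ, rfl⟩ : ∃ μ σ, θ = mkC μ σ := ⟨θ.fst, θ.snd, rfl⟩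
    by_cases hσ : σ = 0
    · subst hσ
      have h : cauchyLaw d (mkC μ 0 : OnePoint (Cplx d)) = Measure.dirac (μ : ExtE d) := if_pos rfl
      rw [h]
      exact map_gReal_dirac (μ : ExtE d)
    by_cases h : mkC μ σ = -imI d
    · rw [map_gReal_cauchyLaw_of_density hd hσ measurable_const
        fun x => by rw [h, cauchyDensity_neg_imI], withDensity_const, h]
      have hg : sphCauchyLaw d (g d ((-imI d : Cplx d) : OnePoint (Cplx d))) =
          (area d Set.univ)⁻¹ • area d :=
        congrArg (sphCauchyLaw d) gFun_neg_imI
      have hG : 0 < Real.Gamma (((d : ℝ) + 1) / 2) := Real.Gamma_pos_of_pos (by positivity)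
      rw [hg, area_univ, ← ENNReal.ofReal_inv_of_pos (by positivity), inv_div]
    · obtain ⟨φ, hφ⟩ : ∃ φ : E (d + 1),
          gFun (mkC μ σ : OnePoint (Cplx d)) = (φ : ExtE (d + 1)) := ⟨_, gFun_mkC h⟩
      have hφ1 : φ ∉ Metric.sphere (0 : E (d + 1)) 1 := fun hm =>
        norm_ne_one_of_gFun hσ h hφ (mem_sphere_zero_iff_norm.1 hm)
      have hg : sphCauchyLaw d (g d (mkC μ σ : OnePoint (Cplx d))) =
          (area d).withDensity fun y => ENNReal.ofReal (sphCauchyDensity d φ y) :=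
        (congrArg (sphCauchyLaw d) hφ).trans (dif_neg hφ1)
      rw [hg]
      refine map_gReal_cauchyLaw_of_density hd hσ ?_ (sphCauchyDensity_gReal hσ h hφ)
      unfold sphCauchyDensity
      fun_prop

theorem map_gReal_symm_sphCauchyLaw {d : ℕ} (hd : 1 ≤ d) (φ : ExtE (d + 1)) :
    (sphCauchyLaw d φ).map (gReal d).symm = cauchyLaw d ((g d).symm φ) := by
  rw [← (g d).apply_symm_apply φ, ← map_gReal_cauchyLaw hd, Equiv.symm_apply_apply,
    Measure.map_map (measurable_gReal_symm d) (measurable_gReal d), Equiv.symm_comp_self,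
    Measure.map_id]

end CauchyStereo

theorem theorem4 (d : ℕ) (hd : 1 ≤ d) {Ω : Type*} [MeasurableSpace Ω] (P : Measure Ω)
    [IsProbabilityMeasure P] :
    (∀ (θ : OnePoint (CauchyStereo.Cplx d)) (X : Ω → CauchyStereo.ExtE d),
      HasLaw X (CauchyStereo.cauchyLaw d θ) P →
        HasLaw (fun ω => CauchyStereo.gReal d (X ω))
          (CauchyStereo.sphCauchyLaw d (CauchyStereo.g d θ)) P) ∧
    (∀ (φ : CauchyStereo.ExtE (d + 1)) (Y : Ω → CauchyStereo.Sph d),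
      HasLaw Y (CauchyStereo.sphCauchyLaw d φ) P →
        HasLaw (fun ω => (CauchyStereo.gReal d).symm (Y ω))
          (CauchyStereo.cauchyLaw d ((CauchyStereo.g d).symm φ)) P) :=

  ⟨fun θ _ hX => HasLaw.fun_comp ⟨(CauchyStereo.measurable_gReal d).aemeasurable,
      CauchyStereo.map_gReal_cauchyLaw hd θ⟩ hX,
    fun φ _ hY => HasLaw.fun_comp ⟨(CauchyStereo.measurable_gReal_symm d).aemeasurable,
      CauchyStereo.map_gReal_symm_sphCauchyLaw hd φ⟩ hY⟩
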